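/- Let $\Gamma$ be a finite directed graph with node set $\mathcal V$ and arc set $\mathcal A$; loops and multiple arcs are allowed. A path is a nonempty sequence of distinct arcs in which each arc begins where the preceding one ends, and a cycle is a closed path that does not pass through the same node twice. The graph $\Gamma$ is strongly connected if for any two distinct nodes $v,v'$ there are a path from $v$ to $v'$ and a path from $v'$ to $v$. Put $$ f_\Gamma=\min\Big\{\sum_{a\in\mathcal A}x_a \;:\; x_a\ge 0 \text{ for all } a\in\mathcal A,\ \ \prod_{a\in\gamma}x_a=1\text{ for every cycle }\gamma\text{ of }\Gamma\Big\}. $$ For $m\ge 1$ let $\mathfrak G_m$ denote the class of all strongly connected finite directed graphs (not necessarily simple) with exactly $m$ arcs. Then for every $m\ge1$ and every $\Gamma\in\mathfrak G_m$ the minimum defining $f_\Gamma$ is attained, and $$ f_\Gamma> e\,\ln(m-\ln m). $$ Moreover, for every $m\ge1$ the minimum of $f_\Gamma$ over $\Gamma\in\mathfrak G_m$ is attained, and $$ \min_{\Gamma\in\mathfrak G_m} f_\Gamma = e\,\ln m+O\left(\frac1{\ln m}\right)\qquad\text{as } m\to\infty . $$ -/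

import Mathlib

open Filter Asymptotics

/-- A directed graph with node set `V` and arc set `A`, given by the beginning `src a` and the
end `tgt a` of every arc `a`. Loops and multiple (parallel) arcs are allowed. -/
structure MultiDigraph (V A : Type*) where
  src : A → V
  tgt : A → V

namespace MultiDigraph

/-- `G.IsPath v w l`: the list `l` of arcs is a path from `v` to `w`, that is, a nonempty sequence
of distinct arcs, each beginning where the previous one ends, starting at `v` and ending at `w`. -/
def IsPath {V A : Type*} (G : MultiDigraph V A) (v w : V) (l : List A) : Prop :=
  l.Nodup ∧ l.IsChain (fun a b => G.tgt a = G.src b) ∧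
    ∃ h : l ≠ [], G.src (l.head h) = v ∧ G.tgt (l.getLast h) = w

/-- `G.IsCycle l`: the list `l` of arcs is a closed path that does not pass through the same node
twice. Cyclic shifts of `l` represent the same cycle. -/
def IsCycle {V A : Type*} (G : MultiDigraph V A) (l : List A) : Prop :=
  (∃ v, G.IsPath v v l) ∧ (l.map G.src).Nodup

/-- Any two distinct nodes are joined by paths in both directions. -/
def StronglyConnected {V A : Type*} (G : MultiDigraph V A) : Prop :=
  ∀ v w : V, v ≠ w → (∃ l, G.IsPath v w l) ∧ (∃ l, G.IsPath w v l)

/-- An assignment of nonnegative values to the arcs for which the product of the arc values along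
every cycle equals `1`. -/
def Feasible {V A : Type*} (G : MultiDigraph V A) (x : A → ℝ) : Prop :=
  (∀ a, 0 ≤ x a) ∧ ∀ l : List A, G.IsCycle l → (l.map x).prod = 1

/-- The set of all sums of arc values over feasible assignments. -/
def arcSums {V A : Type*} [Fintype A] (G : MultiDigraph V A) : Set ℝ :=
  {s | ∃ x : A → ℝ, G.Feasible x ∧ s = ∑ a, x a}

/-- The minimum `f_Γ` of the sum of arc values over feasible assignments. -/
noncomputable def minArcSum {V A : Type*} [Fintype A] (G : MultiDigraph V A) : ℝ :=
  sInf G.arcSums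

/-- The set of values `f_Γ` over all finite strongly connected graphs `Γ` with `m` arcs. -/
def minArcSumValues (m : ℕ) : Set ℝ :=
  {c | ∃ (V A : Type) (_ : Finite V) (_ : Fintype A) (G : MultiDigraph V A),
    G.StronglyConnected ∧ Fintype.card A = m ∧ c = G.minArcSum}

/-- The minimum of `f_Γ` over all finite strongly connected graphs `Γ` with `m` arcs. -/
noncomputable def extremalMinArcSum (m : ℕ) : ℝ :=
  sInf (minArcSumValues m)

end MultiDigraph

namespace MultiDigraph

/-! Lower bound: let `a` carry the least value of a feasible `x` and put `a` on a cycle of `N` arcs.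
The `k = m + 1 - N` arcs that are `a` or off the cycle sum to at least `k * x a`; this and the other
`N - 1` cycle values are `N` numbers with product `k`, so AM-GM gives a sum of at least `N * k ^
(1/N)`. `Feasible.exists_le_sum` states this as a family of tangent bounds in `c`, and
`exp_one_mul_log_lt` chooses `c` for each `N`.

Upper bound: a path closed up by parallel arcs attains `N * k ^ (1/N)`, and `N = ⌈log m⌉` costs only
`O(1 / log m)` over `e * log m`.

The minimum over graphs exists because, up to renaming, only finitely many graphs have `m` arcs. -/

/-- `G.Reachable v w`: one can walk from `v` to `w` along the arcs of `G`. -/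
def Reachable {V A : Type*} (G : MultiDigraph V A) : V → V → Prop :=
  Relation.ReflTransGen fun v w => ∃ a, G.src a = v ∧ G.tgt a = w

/-! ### Paths, cycles and potentials -/

section Paths

variable {V A : Type*} {G : MultiDigraph V A}

theorem isPath_singleton (a : A) : G.IsPath (G.src a) (G.tgt a) [a] := by
  simp [IsPath]

theorem IsPath.cons {a : A} {w : V} {l : List A} (h : G.IsPath (G.tgt a) w l) (ha : a ∉ l) :
    G.IsPath (G.src a) w (a :: l) := by
  obtain ⟨h1, h2, h3, h4, h5⟩ := h
  refine ⟨List.nodup_cons.2 ⟨ha, h1⟩, ?_, by simp, by simp, ?_⟩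
  · cases l with
    | nil => exact absurd rfl h3
    | cons b l => exact List.isChain_cons_cons.2 ⟨h4.symm, h2⟩
  · rw [List.getLast_cons h3]; exact h5

theorem IsPath.suffix {v w : V} {p q : List A} {b : A} (h : G.IsPath v w (p ++ b :: q)) :
    G.IsPath (G.src b) w (b :: q) := by
  obtain ⟨h1, h2, h3, h4, h5⟩ := h
  refine ⟨h1.of_append_right, h2.right_of_append, by simp, by simp, ?_⟩
  rw [← h5, List.getLast_append_of_ne_nil _ (by simp)]

theorem IsPath.prod_potential {v w : V} {l : List A} (h : G.IsPath v w l) {t : V → ℝ}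
    (ht : ∀ v, t v ≠ 0) : (l.map fun a => t (G.tgt a) / t (G.src a)).prod = t w / t v := by
  induction l generalizing v with
  | nil => exact absurd rfl h.2.2.1
  | cons a l ih =>
    obtain ⟨h1, h2, h3, h4, h5⟩ := h
    simp only [List.head_cons] at h4
    cases l with
    | nil => simp at h5; simp [h4, h5]
    | cons b l =>
      have hb := List.isChain_cons_cons.1 h2
      have := ih (v := G.tgt a) ⟨(List.nodup_cons.1 h1).2, hb.2, by simp, by simpa using hb.1.symm,
        by rw [← h5, List.getLast_cons (List.cons_ne_nil b l)]⟩
      rw [List.map_cons, List.prod_cons, this, h4]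
      have := ht (G.tgt a)
      field_simp

theorem IsPath.reachable {v w : V} {l : List A} (h : G.IsPath v w l) : G.Reachable v w := by
  induction l generalizing v with
  | nil => exact absurd rfl h.2.2.1
  | cons a l ih =>
    obtain ⟨h1, h2, h3, h4, h5⟩ := h
    simp only [List.head_cons] at h4
    refine Relation.ReflTransGen.head ⟨a, h4, rfl⟩ ?_
    cases l with
    | nil => simp at h5; rw [h5]
    | cons b l =>
      have hb := List.isChain_cons_cons.1 h2
      exact ih ⟨(List.nodup_cons.1 h1).2, hb.2, by simp, by simpa using hb.1.symm,
        by rw [← h5, List.getLast_cons (List.cons_ne_nil b l)]⟩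

/-- Prepend arcs one at a time; if the new source was already visited, keep only the part of the
path from that visit on. -/
theorem Reachable.exists_simple_path {v w : V} (h : G.Reachable v w) (hvw : v ≠ w) :
    ∃ l, G.IsPath v w l ∧ (l.map G.src).Nodup ∧ w ∉ l.map G.src := by
  induction h using Relation.ReflTransGen.head_induction_on with
  | refl => exact absurd rfl hvw
  | @head v c hvc _ ih =>
    obtain ⟨a, rfl, rfl⟩ := hvc
    by_cases hc : G.tgt a = w
    · exact ⟨[a], hc ▸ isPath_singleton a, by simp, by simpa using hvw.symm⟩
    obtain ⟨l, hl, hn, hw⟩ := ih hc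
    by_cases hv : G.src a ∈ l.map G.src
    · obtain ⟨b, hb, hba⟩ := List.mem_map.1 hv
      obtain ⟨p, q, rfl⟩ := List.append_of_mem hb
      rw [List.map_append] at hn hw
      exact ⟨b :: q, hba ▸ hl.suffix, hn.of_append_right,
        fun h => hw (List.mem_append_right _ h)⟩
    · refine ⟨a :: l, hl.cons fun h => hv (List.mem_map_of_mem h), ?_, ?_⟩
      · rw [List.map_cons, List.nodup_cons]; exact ⟨hv, hn⟩
      · rw [List.map_cons, List.mem_cons]
        rintro (h | h)
        exacts [hvw h.symm, hw h]

theorem stronglyConnected_of_reachable (h : ∀ v w, G.Reachable v w) : G.StronglyConnected :=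
  fun v w hvw => ⟨((h v w).exists_simple_path hvw).imp fun _ h => h.1,
    ((h w v).exists_simple_path hvw.symm).imp fun _ h => h.1⟩

theorem StronglyConnected.exists_isCycle_cons (hG : G.StronglyConnected) (a : A) :
    ∃ l, G.IsCycle (a :: l) := by
  by_cases h : G.tgt a = G.src a
  · have := isPath_singleton (G := G) a
    rw [h] at this
    exact ⟨[], ⟨_, this⟩, by simp⟩
  · obtain ⟨⟨p, hp⟩, -⟩ := hG _ _ h
    obtain ⟨l, hl, hn, hs⟩ := hp.reachable.exists_simple_path h
    refine ⟨l, ⟨_, hl.cons fun h => hs (List.mem_map_of_mem h)⟩, ?_⟩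
    rw [List.map_cons, List.nodup_cons]
    exact ⟨hs, hn⟩

theorem StronglyConnected.src_surjective [Nonempty A] (hG : G.StronglyConnected) :
    Function.Surjective G.src := by
  intro v
  by_cases h : ∃ w, v ≠ w
  · obtain ⟨w, hw⟩ := h
    obtain ⟨⟨l, hl⟩, -⟩ := hG v w hw
    exact ⟨_, hl.2.2.2.1⟩
  · push Not at h
    exact ⟨Classical.arbitrary A, (h _).symm⟩

theorem feasible_potential {t : V → ℝ} (ht : ∀ v, 0 < t v) :
    G.Feasible fun a => t (G.tgt a) / t (G.src a) := by
  refine ⟨fun a => (div_pos (ht _) (ht _)).le, ?_⟩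
  rintro l ⟨⟨v, hv⟩, -⟩
  rw [hv.prod_potential fun v => (ht v).ne', div_self (ht v).ne']

theorem Feasible.pos {x : A → ℝ} (hx : G.Feasible x) (hG : G.StronglyConnected) (a : A) :
    0 < x a := by
  obtain ⟨l, hl⟩ := hG.exists_isCycle_cons a
  refine (hx.1 a).lt_of_ne fun h => ?_
  have := hx.2 _ hl
  simp [← h] at this

end Paths

/-! ### Existence of both minima -/

section Minimum

theorem isLeast_minArcSum {V A : Type*} [Fintype A] (G : MultiDigraph V A) :
    IsLeast G.arcSums G.minArcSum := by
  have hone : G.Feasible fun _ => 1 := ⟨fun _ => zero_le_one, fun l _ => by simp⟩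
  have hclosed : IsClosed {x : A → ℝ | G.Feasible x} := by
    have : {x : A → ℝ | G.Feasible x} =
        (⋂ a, {x | 0 ≤ x a}) ∩ ⋂ l, ⋂ (_ : G.IsCycle l), {x | (l.map x).prod = 1} := by
      ext x; simp [Feasible]
    rw [this]
    refine (isClosed_iInter fun a => isClosed_le continuous_const (continuous_apply a)).inter
      (isClosed_iInter fun l => isClosed_iInter fun _ => isClosed_eq ?_ continuous_const)
    exact continuous_list_prod l fun a _ => continuous_apply a
  -- The constant `1` has sum `Fintype.card A`, so only assignments inside this box can do better.
  have hcompact : IsCompact ({x : A → ℝ | G.Feasible x} ∩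
      Set.pi Set.univ fun _ => Set.Icc 0 (Fintype.card A : ℝ)) :=
    (isCompact_univ_pi fun _ => isCompact_Icc).inter_left hclosed
  have hone_mem : (fun _ => 1) ∈ {x : A → ℝ | G.Feasible x} ∩
      Set.pi Set.univ fun _ => Set.Icc 0 (Fintype.card A : ℝ) := by
    refine ⟨hone, fun a _ => ⟨zero_le_one, ?_⟩⟩
    have h : 1 ≤ Fintype.card A := Fintype.card_pos_iff.2 ⟨a⟩
    exact Nat.one_le_cast.2 h
  have hcont : Continuous fun x : A → ℝ => ∑ a, x a := by fun_prop
  obtain ⟨x, hx, hmin⟩ := hcompact.exists_isMinOn ⟨_, hone_mem⟩ hcont.continuousOn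
  have hleast : IsLeast G.arcSums (∑ a, x a) := by
    refine ⟨⟨x, hx.1, rfl⟩, ?_⟩
    rintro _ ⟨y, hy, rfl⟩
    by_cases hys : ∑ a, y a ≤ Fintype.card A
    · refine hmin ⟨hy, fun a _ => ⟨hy.1 a, le_trans ?_ hys⟩⟩
      exact Finset.single_le_sum (fun b _ => hy.1 b) (Finset.mem_univ a)
    · refine le_trans ?_ (not_le.1 hys).le
      exact (hmin hone_mem).trans (by simp)
  rw [minArcSum, hleast.csInf_eq]
  exact hleast

/-- Replace the nodes by their images under `f`, and the arcs by their images under `e`. -/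
def reindex {V A W B : Type*} (G : MultiDigraph V A) (f : V → W) (e : A ≃ B) :
    MultiDigraph W B where
  src b := f (G.src (e.symm b))
  tgt b := f (G.tgt (e.symm b))

theorem isCycle_reindex {V A W B : Type*} (G : MultiDigraph V A) {f : V → W}
    (hf : Function.Injective f) (e : A ≃ B) (l : List A) :
    (G.reindex f e).IsCycle (l.map e) ↔ G.IsCycle l := by
  have hsrc : (l.map e).map (G.reindex f e).src = (l.map G.src).map f := by
    simp [reindex, Function.comp_def]
  rw [IsCycle, IsCycle, hsrc, List.nodup_map_iff hf]
  refine and_congr_left fun _ => ?_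
  simp only [IsPath, List.nodup_map_iff e.injective, List.isChain_map, exists_and_left]
  refine and_congr_right fun _ => and_congr ?_ ?_
  · simp [reindex, hf.eq_iff]
  · simp [reindex, List.head_map, List.getLast_map, hf.eq_iff]

theorem minArcSum_reindex {V A W B : Type*} [Fintype A] [Fintype B] (G : MultiDigraph V A)
    {f : V → W} (hf : Function.Injective f) (e : A ≃ B) :
    (G.reindex f e).minArcSum = G.minArcSum := by
  unfold minArcSum
  congr 1
  ext s
  constructor
  · rintro ⟨x, hx, rfl⟩
    refine ⟨x ∘ e, ⟨fun a => hx.1 _, fun l hl => ?_⟩, (e.sum_comp x).symm⟩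
    rw [← hx.2 _ ((isCycle_reindex G hf e l).2 hl), List.map_map]
  · rintro ⟨x, hx, rfl⟩
    refine ⟨x ∘ e.symm, ⟨fun a => hx.1 _, fun l hl => ?_⟩, (e.symm.sum_comp x).symm⟩
    have hl' : l = (l.map e.symm).map e := by simp
    rw [hl', isCycle_reindex G hf] at hl
    rw [← hx.2 _ hl, List.map_map]

/-- Every node is the source of some arc, so the nodes embed into the arcs and the graph can be
copied onto `Fin m`. -/
theorem finite_minArcSumValues {m : ℕ} (hm : 1 ≤ m) : (minArcSumValues m).Finite := by
  refine (Set.finite_range fun p : (Fin m → Fin m) × (Fin m → Fin m) =>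
    (⟨p.1, p.2⟩ : MultiDigraph (Fin m) (Fin m)).minArcSum).subset ?_
  rintro _ ⟨V, A, _, _, G, hG, hA, rfl⟩
  have : Nonempty A := Fintype.card_pos_iff.1 (by omega)
  let e := Fintype.equivFinOfCardEq hA
  have hf : Function.Injective (e ∘ Function.surjInv hG.src_surjective) :=
    e.injective.comp (Function.injective_surjInv _)
  let G' := G.reindex (e ∘ Function.surjInv hG.src_surjective) e
  exact ⟨(G'.src, G'.tgt), minArcSum_reindex G hf e⟩

theorem nonempty_minArcSumValues (m : ℕ) : (minArcSumValues m).Nonempty :=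
  ⟨_, Unit, Fin m, inferInstance, inferInstance, ⟨fun _ => (), fun _ => ()⟩,
    fun _ _ h => absurd rfl h, by simp, rfl⟩

theorem isLeast_extremalMinArcSum {m : ℕ} (hm : 1 ≤ m) :
    IsLeast (minArcSumValues m) (extremalMinArcSum m) :=
  ⟨(nonempty_minArcSumValues m).csInf_mem (finite_minArcSumValues hm),
    fun _ h => csInf_le (finite_minArcSumValues hm).bddBelow h⟩

end Minimum

/-! ### Lower bound -/

section LowerBound

/-- Tangent line of `exp` at `c`, evaluated at `log y`. Summed over several numbers, it replaces
AM-GM without roots. -/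
theorem exp_mul_le_of_pos (c : ℝ) {y : ℝ} (hy : 0 < y) :
    Real.exp c * (1 + Real.log y - c) ≤ y := by
  have h := Real.add_one_le_exp (Real.log y - c)
  calc Real.exp c * (1 + Real.log y - c) ≤ Real.exp c * Real.exp (Real.log y - c) := by
        gcongr; linarith
    _ = y := by rw [← Real.exp_add, add_sub_cancel, Real.exp_log hy]

theorem exp_mul_le_sum_map {A : Type*} {x : A → ℝ} (hx : ∀ a, 0 < x a) (c : ℝ) (l : List A) :
    Real.exp c * (l.length * (1 - c) + Real.log (l.map x).prod) ≤ (l.map x).sum := by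
  induction l with
  | nil => simp
  | cons a l ih =>
    have hp : 0 < (l.map x).prod := List.prod_pos (by simpa using fun b _ => hx b)
    have h := exp_mul_le_of_pos c (hx a)
    simp only [List.map_cons, List.prod_cons, List.sum_cons, List.length_cons]
    rw [Real.log_mul (hx a).ne' hp.ne']
    push_cast
    linarith

theorem Feasible.exists_le_sum {V A : Type*} [Fintype A] [Nonempty A] {G : MultiDigraph V A}
    (hG : G.StronglyConnected) {x : A → ℝ} (hx : G.Feasible x) :
    ∃ N : ℕ, 1 ≤ N ∧ N ≤ Fintype.card A ∧ ∀ c : ℝ,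
      Real.exp c * (N * (1 - c) + Real.log (Fintype.card A + 1 - N)) ≤ ∑ a, x a := by
  classical
  obtain ⟨a, ha⟩ := Finite.exists_min x
  obtain ⟨l, hl⟩ := hG.exists_isCycle_cons a
  have hnodup : (a :: l).Nodup := hl.1.choose_spec.1
  have hlen : l.length + 1 ≤ Fintype.card A := by simpa using hnodup.length_le_card
  refine ⟨l.length + 1, by omega, hlen, fun c => ?_⟩
  have hpos := hx.pos hG
  have hk : (0 : ℝ) < Fintype.card A - l.length := by
    have : ((l.length + 1 : ℕ) : ℝ) ≤ Fintype.card A := by exact_mod_cast hlen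
    push_cast at this; linarith
  have hprod : Real.log (x a) + Real.log (l.map x).prod = 0 := by
    rw [← Real.log_mul (hpos a).ne' (List.prod_pos (by simpa using fun b _ => hpos b)).ne',
      ← List.prod_cons, ← List.map_cons, hx.2 _ hl, Real.log_one]
  have h1 := exp_mul_le_sum_map hpos c l
  have h2 := exp_mul_le_of_pos c (mul_pos hk (hpos a))
  rw [Real.log_mul hk.ne' (hpos a).ne'] at h2
  -- The complement of `l` still contains `a`, hence `m + 1 - N` arcs.
  have h3 : (Fintype.card A - l.length : ℝ) * x a ≤ ∑ b ∈ l.toFinsetᶜ, x b := by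
    have hc : ((l.toFinsetᶜ.card : ℕ) : ℝ) = Fintype.card A - l.length := by
      rw [Finset.card_compl, List.toFinset_card_of_nodup hnodup.of_cons,
        Nat.cast_sub (by omega)]
    rw [← hc, ← nsmul_eq_mul]
    exact Finset.card_nsmul_le_sum _ _ _ fun b _ => ha b
  have h4 : (l.map x).sum = ∑ b ∈ l.toFinset, x b :=
    (List.sum_toFinset x hnodup.of_cons).symm
  have h5 := Finset.sum_add_sum_compl l.toFinset x
  push_cast
  have h6 : (Fintype.card A : ℝ) + 1 - (l.length + 1) = Fintype.card A - l.length := by ring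
  rw [h6]
  have h7 : Real.log (l.map x).prod = - Real.log (x a) := by linarith
  rw [h7] at h1
  linarith

theorem exp_one_mul_log_le {y : ℝ} (hy : 0 < y) : Real.exp 1 * Real.log y ≤ y := by
  simpa using exp_mul_le_of_pos 1 hy

/-- With `L = log y` this is `L ^ 2 + L + 1 ≤ exp L`, proved by truncating the exponential series.
It fails at `y = 6`. -/
theorem sq_log_add_one_le {y : ℝ} (hy : 7 ≤ y) : (Real.log y + 1) ^ 2 ≤ y + Real.log y := by
  have h0 : (19 / 10 : ℝ) ≤ Real.log y := by
    rw [Real.le_log_iff_exp_le (by linarith)]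
    refine le_trans ?_ hy
    have h1 := Real.exp_one_lt_d9
    have : Real.exp (19 / 10) ^ 10 ≤ 7 ^ 10 := by
      rw [← Real.exp_nat_mul]
      norm_num
      rw [show (19 : ℝ) = (19 : ℕ) * 1 by norm_num, Real.exp_nat_mul]
      calc Real.exp 1 ^ 19 ≤ 2.7182818286 ^ 19 := by gcongr
        _ ≤ _ := by norm_num
    exact (pow_le_pow_iff_left₀ (Real.exp_pos _).le (by norm_num) (by norm_num)).1 this
  have h1 := Real.sum_le_exp_of_nonneg (x := Real.log y) (by linarith) 6
  rw [Real.exp_log (by linarith)] at h1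
  simp [Finset.sum_range_succ, Nat.factorial] at h1
  set L := Real.log y
  nlinarith [mul_nonneg (sq_nonneg L) (sub_nonneg.2 h0), pow_le_pow_left₀ (by norm_num) h0 2,
    pow_le_pow_left₀ (by norm_num) h0 3,
    mul_le_mul_of_nonneg_left (pow_le_pow_left₀ (by norm_num) h0 2) (sq_nonneg L),
    mul_le_mul_of_nonneg_left (pow_le_pow_left₀ (by norm_num) h0 3) (sq_nonneg L)]

theorem exp_one_mul_log_lt_of_seven_le {y N S : ℝ} (hy : 7 ≤ y) (hN : Real.log y + 1 ≤ N)
    (hNy : N ≤ y) (hS : ∀ c : ℝ, Real.exp c * (N * (1 - c) + Real.log (y + 1 - N)) ≤ S) :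
    Real.exp 1 * Real.log (y - Real.log y) < S := by
  have hsq := sq_log_add_one_le hy
  have hL : 0 < Real.log y := Real.log_pos (by linarith)
  have hLy : Real.log y < y - 1 := Real.log_lt_sub_one_of_pos (by linarith) (by linarith)
  have hK0 : 0 < Real.log (y - Real.log y) := Real.log_pos (by linarith)
  have hKL : Real.log (y - Real.log y) ≤ Real.log y - Real.log y / y := by
    have h := Real.log_le_sub_one_of_pos (x := (y - Real.log y) / y)
      (div_pos (by linarith) (by linarith))
    rw [Real.log_div (by linarith) (by linarith), sub_div, div_self (by linarith)] at h
    linarith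
  set L := Real.log y
  set K := Real.log (y - L)
  have hLyy : 0 < L / y := div_pos hL (by linarith)
  -- With this `c`, the bracket in `hS` equals `L + 1` at `N = L + 1`, and `exp (c - 1) > c` then
  -- yields more than `K`.
  set c := K / (L + 1) with hc
  have hcL : c * (L + 1) = K := div_mul_cancel₀ _ (by linarith)
  have hc0 : 0 < c := div_pos hK0 (by linarith)
  have hc1 : c < 1 := by rw [hc, div_lt_one (by linarith)]; linarith
  have hexp : c < Real.exp (c - 1) := by
    have := Real.add_one_lt_exp (x := c - 1) (by linarith)
    linarith
  have hconc : ConcaveOn ℝ (Set.Ioi 0) fun k : ℝ => (y + 1 - k) * (1 - c) + Real.log k := by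
    refine ConcaveOn.add ?_ strictConcaveOn_log_Ioi.concaveOn
    refine ⟨convex_Ioi 0, fun u _ v _ a b _ _ hab => le_of_eq ?_⟩
    simp only [smul_eq_mul]
    linear_combination (y + 1) * (1 - c) * hab
  -- By concavity in `k = y + 1 - N`, only the endpoints `k = 1` and `k = y - L` need checking.
  have hmin := hconc.min_le_of_mem_Icc (x := 1) (y := y - L) (z := y + 1 - N)
    (by simp) (Set.mem_Ioi.2 (by linarith)) ⟨by linarith, by linarith⟩
  have hS' : Real.exp (c - 1) * (N * (1 - c) + Real.log (y + 1 - N)) ≤ S / Real.exp 1 := by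
    rw [le_div_iff₀ (Real.exp_pos 1), mul_right_comm, ← Real.exp_add, sub_add_cancel]
    exact hS c
  suffices h : K < S / Real.exp 1 by
    rw [lt_div_iff₀ (Real.exp_pos 1)] at h
    linarith
  refine lt_of_lt_of_le ?_ hS'
  have hK : K = c * (L + 1) := hcL.symm
  simp only [Real.log_one, add_zero, add_sub_cancel_right, sub_sub_cancel] at hmin
  rcases min_le_iff.1 hmin with h | h
  · have hyd : L + 1 ≤ y * (1 - c) := by
      have h1 : (L + 1) * (y * (1 - c)) = y * (L + 1 - K) := by rw [hK]; ring
      have h2 : y * (1 + L / y) ≤ y * (L + 1 - K) := by gcongr; linarith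
      rw [mul_add, mul_one, mul_div_cancel₀ _ (by linarith)] at h2
      nlinarith
    calc K = c * (L + 1) := hK
      _ < Real.exp (c - 1) * (L + 1) := by gcongr
      _ ≤ _ := mul_le_mul_of_nonneg_left (hyd.trans h) (Real.exp_pos _).le
  · calc K = c * (L + 1) := hK
      _ < Real.exp (c - 1) * (L + 1) := by gcongr
      _ ≤ _ := by
        refine mul_le_mul_of_nonneg_left (le_trans (le_of_eq ?_) h) (Real.exp_pos _).le
        change L + 1 = (y + 1 - (y - L)) * (1 - c) + K
        rw [hK]; ring

theorem one_lt_log_three : 1 < Real.log 3 := by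
  rw [Real.lt_log_iff_exp_lt (by norm_num)]
  linarith [Real.exp_one_lt_d9]

theorem exp_one_mul_log_lt {m N : ℕ} (hm : 1 ≤ m) (hN : 1 ≤ N) (hNm : N ≤ m) {S : ℝ}
    (hS : ∀ c : ℝ, Real.exp c * (N * (1 - c) + Real.log (m + 1 - N)) ≤ S) :
    Real.exp 1 * Real.log (m - Real.log m) < S := by
  have hm' : (1 : ℝ) ≤ m := by exact_mod_cast hm
  have hNm' : (N : ℝ) ≤ m := by exact_mod_cast hNm
  have hLm : Real.log m ≤ m - 1 := Real.log_le_sub_one_of_pos (by linarith)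
  rcases lt_or_ge (N : ℝ) (Real.log m + 1) with h | h
  · refine lt_of_lt_of_le ?_ (hS 1)
    rw [sub_self, mul_zero, zero_add]
    exact mul_lt_mul_of_pos_left (Real.log_lt_log (by linarith) (by linarith)) (Real.exp_pos 1)
  rcases le_or_gt 7 m with h7 | h7
  · exact exp_one_mul_log_lt_of_seven_le (by exact_mod_cast h7) h hNm' hS
  rcases hm.eq_or_lt with rfl | hm2
  · obtain rfl : N = 1 := by omega
    have := hS 0
    norm_num at this ⊢
    linarith
  -- For `2 ≤ m ≤ 6`, `e * log t ≤ t` and the bound at `c = 0` leave finitely many numerical cases.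
  refine (exp_one_mul_log_le (by linarith)).trans_lt ?_
  refine lt_of_lt_of_le ?_ (hS 0)
  rw [Real.exp_zero, one_mul, sub_zero, mul_one]
  have h2 : 0 < Real.log 2 := Real.log_pos (by norm_num)
  have h3 := one_lt_log_three
  have h4 : Real.log 3 < Real.log 4 := Real.log_lt_log (by norm_num) (by norm_num)
  have h5 : Real.log 3 < Real.log 5 := Real.log_lt_log (by norm_num) (by norm_num)
  have h6 : Real.log 3 < Real.log 6 := Real.log_lt_log (by norm_num) (by norm_num)
  have h24 : 3 < Real.log 4 + Real.log 6 := by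
    rw [← Real.log_mul (by norm_num) (by norm_num), Real.lt_log_iff_exp_lt (by norm_num),
      show (3 : ℝ) = (3 : ℕ) * 1 by norm_num, Real.exp_nat_mul]
    calc Real.exp 1 ^ 3 < 2.7182818286 ^ 3 := by gcongr; exact Real.exp_one_lt_d9
      _ < _ := by norm_num
  interval_cases m <;> interval_cases N <;> norm_num at h ⊢ <;> linarith

theorem exp_one_mul_log_lt_minArcSum {V A : Type*} [Fintype A] [Nonempty A]
    {G : MultiDigraph V A} (hG : G.StronglyConnected) :
    Real.exp 1 * Real.log (Fintype.card A - Real.log (Fintype.card A)) < G.minArcSum := by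
  obtain ⟨x, hx, hs⟩ := (isLeast_minArcSum G).1
  obtain ⟨N, h1, h2, h3⟩ := Feasible.exists_le_sum hG hx
  rw [hs]
  exact exp_one_mul_log_lt Fintype.card_pos h1 h2 h3

end LowerBound

/-! ### Upper bound and asymptotics -/

section UpperBound

/-- The graph with `m` arcs formed by a path through the nodes `0, …, n` and by
`m - n` parallel arcs from `n` to `0`. -/
def bundledCycle (n m : ℕ) : MultiDigraph (Fin (n + 1)) (Fin m) where
  src i := if h : i.1 < n then ⟨i, by omega⟩ else ⟨n, by omega⟩
  tgt i := if h : i.1 < n then ⟨i + 1, by omega⟩ else ⟨0, by omega⟩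

theorem bundledCycle_stronglyConnected {n m : ℕ} (h : n < m) :
    (bundledCycle n m).StronglyConnected := by
  have hstep : ∀ i (hi : i < n), (bundledCycle n m).Reachable ⟨i, by omega⟩ ⟨i + 1, by omega⟩ :=
    fun i hi => .single ⟨⟨i, by omega⟩, by simp [bundledCycle, hi], by simp [bundledCycle, hi]⟩
  have hback : (bundledCycle n m).Reachable ⟨n, by omega⟩ ⟨0, by omega⟩ :=
    .single ⟨⟨n, h⟩, by simp [bundledCycle], by simp [bundledCycle]⟩
  have hfrom : ∀ i (hi : i ≤ n), (bundledCycle n m).Reachable ⟨0, by omega⟩ ⟨i, by omega⟩ := by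
    intro i
    induction i with
    | zero => exact fun _ => .refl
    | succ i ih => exact fun hi => (ih (by omega)).trans (hstep i (by omega))
  have hto : ∀ i (hi : i ≤ n), (bundledCycle n m).Reachable ⟨i, by omega⟩ ⟨n, by omega⟩ :=
    fun i hi => by
      induction hi using Nat.decreasingInduction with
      | self => exact .refl
      | of_succ k hk ih => exact (hstep k hk).trans ih
  exact stronglyConnected_of_reachable fun v w =>
    ((hto v (by omega)).trans hback).trans (hfrom w (by omega))

theorem minArcSum_bundledCycle_le {n m : ℕ} (h : n < m) {q : ℝ} (hq : 0 < q)
    (hqm : q ^ (n + 1) = m - n) : (bundledCycle n m).minArcSum ≤ (n + 1) * q := by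
  -- Path arcs get `q` and each parallel arc `q⁻ⁿ`; by `hqm` the parallel arcs together also sum to
  -- `q`.
  have hx := feasible_potential (G := bundledCycle n m) (t := fun i => q ^ i.1)
    fun v => pow_pos hq _
  refine ((isLeast_minArcSum _).2 ⟨_, hx, rfl⟩).trans (le_of_eq ?_)
  obtain ⟨k, rfl⟩ := Nat.exists_eq_add_of_lt h
  have hval : ∀ i : Fin (n + k + 1), q ^ ((bundledCycle n (n + k + 1)).tgt i).1 /
      q ^ ((bundledCycle n (n + k + 1)).src i).1 = if i.1 < n then q else 1 / q ^ n := by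
    intro i
    by_cases hi : i.1 < n
    · have := hq.ne'
      simp only [bundledCycle, hi, dif_pos, if_pos]
      field_simp
      rw [pow_succ]
    · simp [bundledCycle, hi]
  simp only [hval]
  rw [Fin.sum_univ_eq_sum_range (fun i => if i < n then q else 1 / q ^ n), add_assoc,
    Finset.sum_range_add, Finset.sum_congr rfl fun i hi => if_pos (Finset.mem_range.1 hi),
    Finset.sum_congr rfl fun i _ => if_neg (show ¬ n + i < n by omega)]
  push_cast at hqm ⊢
  have hk : (k : ℝ) + 1 = q ^ (n + 1) := by linarith
  simp only [Finset.sum_const, Finset.card_range, nsmul_eq_mul]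
  push_cast
  have := hq.ne'
  rw [hk]
  field_simp
  ring

theorem extremalMinArcSum_le {m : ℕ} (hm : 2 ≤ m) :
    extremalMinArcSum m ≤ Real.exp 1 * (Real.log m + 1 / Real.log m) := by
  have hm' : (2 : ℝ) ≤ m := by exact_mod_cast hm
  have hL : 0 < Real.log m := Real.log_pos (by linarith)
  have hLm : Real.log m ≤ m - 1 := Real.log_le_sub_one_of_pos (by linarith)
  obtain ⟨n, hn⟩ : ∃ n, ⌈Real.log m⌉₊ = n + 1 :=
    Nat.exists_eq_succ_of_ne_zero (Nat.ceil_pos.2 hL).ne'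
  have hn1 : Real.log m ≤ n + 1 := by
    have := Nat.le_ceil (Real.log m)
    rw [hn] at this; exact_mod_cast this
  have hn2 : (n : ℝ) + 1 < Real.log m + 1 := by
    have := Nat.ceil_lt_add_one hL.le
    rw [hn] at this; exact_mod_cast this
  have hnm : n < m := by
    have : (n : ℝ) < m := by linarith
    exact_mod_cast this
  have hN : (0 : ℝ) < n + 1 := by positivity
  have hk : (0 : ℝ) < m - n := by
    have : (n : ℝ) < m := by exact_mod_cast hnm
    linarith
  have hle : extremalMinArcSum m ≤ (bundledCycle n m).minArcSum :=
    (isLeast_extremalMinArcSum (by omega)).2 ⟨Fin (n + 1), Fin m, inferInstance, inferInstance,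
      bundledCycle n m, bundledCycle_stronglyConnected hnm, by simp, rfl⟩
  have hub := minArcSum_bundledCycle_le hnm (Real.exp_pos (Real.log (m - n) / (n + 1))) (by
    rw [← Real.exp_nat_mul]
    push_cast
    rw [mul_div_cancel₀ _ hN.ne', Real.exp_log hk])
  refine hle.trans (hub.trans ?_)
  have hlog : Real.log (m - n) ≤ Real.log m := Real.log_le_log hk (by linarith [n.cast_nonneg (α := ℝ)])
  set L := Real.log m
  have h1 : Real.exp (Real.log (m - n) / (n + 1)) ≤
      Real.exp 1 * Real.exp (-((n + 1 - L) / (n + 1))) := by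
    rw [← Real.exp_add]
    gcongr
    have : 1 + -((n + 1 - L) / (n + 1)) = L / ((n : ℝ) + 1) := by field_simp; ring
    rw [this]
    gcongr
  have hs : 0 ≤ (n + 1 - L) / ((n : ℝ) + 1) := div_nonneg (by linarith) hN.le
  have h2 : Real.exp (-((n + 1 - L) / (n + 1))) ≤ (1 + (n + 1 - L) / ((n : ℝ) + 1))⁻¹ := by
    rw [Real.exp_neg]
    gcongr
    linarith [Real.add_one_le_exp ((n + 1 - L) / ((n : ℝ) + 1))]
  -- With `N = n + 1`, `N ^ 2 - L * (2 * N - L) = (N - L) ^ 2 ≤ 1`, as `N` is the ceiling of `L`.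
  have h3 : ((n : ℝ) + 1) * (1 + (n + 1 - L) / ((n : ℝ) + 1))⁻¹ ≤ L + 1 / L := by
    have he : ((n : ℝ) + 1) * (1 + (n + 1 - L) / ((n : ℝ) + 1))⁻¹ =
        (n + 1) ^ 2 / (n + 1 + (n + 1 - L)) := by
      have : (1 : ℝ) + n + (1 + n - L) ≠ 0 := by linarith
      field_simp
    rw [he, div_le_iff₀ (by linarith)]
    have h4 : 1 / L * (n + 1 + (n + 1 - L)) ≥ 1 := by
      rw [ge_iff_le, one_div, ← div_eq_inv_mul, le_div_iff₀ hL]; linarith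
    nlinarith
  calc ((n : ℝ) + 1) * Real.exp (Real.log (m - n) / (n + 1))
      ≤ (n + 1) * (Real.exp 1 * (1 + (n + 1 - L) / ((n : ℝ) + 1))⁻¹) := by
        gcongr; exact h1.trans (by gcongr)
    _ = Real.exp 1 * ((n + 1) * (1 + (n + 1 - L) / ((n : ℝ) + 1))⁻¹) := by ring
    _ ≤ _ := by gcongr

theorem exp_one_mul_log_lt_extremalMinArcSum {m : ℕ} (hm : 1 ≤ m) :
    Real.exp 1 * Real.log (m - Real.log m) < extremalMinArcSum m := by
  obtain ⟨V, A, _, _, G, hG, rfl, h⟩ := (isLeast_extremalMinArcSum hm).1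
  have : Nonempty A := Fintype.card_pos_iff.1 hm
  rw [h]
  exact exp_one_mul_log_lt_minArcSum hG

theorem le_log_sub_log {y : ℝ} (hy : 7 ≤ y) :
    Real.log y - 2 / Real.log y ≤ Real.log (y - Real.log y) := by
  have hsq := sq_log_add_one_le hy
  have hL : 0 < Real.log y := Real.log_pos (by linarith)
  set L := Real.log y with hLdef
  have h2 : 2 * L ≤ y := by nlinarith
  have hlow : 1 - y / (y - L) ≤ Real.log (y - L) - L := by
    have h := Real.one_sub_inv_le_log_of_pos (x := (y - L) / y)
      (div_pos (by linarith) (by linarith))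
    rwa [Real.log_div (by linarith) (by linarith), inv_div, ← hLdef] at h
  have h3 : y / (y - L) - 1 ≤ 2 / L := by
    rw [div_sub_one (by linarith), div_le_div_iff₀ (by linarith) hL]
    nlinarith
  linarith

theorem extremalMinArcSum_isBigO :
    (fun m : ℕ => extremalMinArcSum m - Real.exp 1 * Real.log (m : ℝ))
      =O[atTop] (fun m : ℕ => 1 / Real.log (m : ℝ)) := by
  refine IsBigO.of_bound (Real.exp 1 * 2) ?_
  filter_upwards [eventually_ge_atTop 7] with m hm
  have hm' : (7 : ℝ) ≤ m := by exact_mod_cast hm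
  have hL : 0 < Real.log m := Real.log_pos (by linarith)
  have h1 := extremalMinArcSum_le (m := m) (by omega)
  have h2 := exp_one_mul_log_lt_extremalMinArcSum (m := m) (by omega)
  have h3 := mul_le_mul_of_nonneg_left (le_log_sub_log hm') (Real.exp_pos 1).le
  have h4 : 0 < Real.exp 1 * (1 / Real.log m) := by positivity
  rw [Real.norm_eq_abs, Real.norm_eq_abs, abs_of_pos (one_div_pos.2 hL), abs_le]
  have h5 : Real.exp 1 * (Real.log m - 2 / Real.log m) =
    Real.exp 1 * Real.log m - Real.exp 1 * 2 * (1 / Real.log m) := by ring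
  constructor <;> linarith

end UpperBound

end MultiDigraph

/-- Both minima in the statement are asserted to be attained; the asymptotic formula is understood
for the number of arcs tending to infinity. -/
theorem mainTheorem3 :
    (∀ (V A : Type*) [Finite V] [Fintype A] (G : MultiDigraph V A),
      G.StronglyConnected → ∀ m : ℕ, 1 ≤ m → Fintype.card A = m →
        IsLeast G.arcSums G.minArcSum ∧
        Real.exp 1 * Real.log ((m : ℝ) - Real.log (m : ℝ)) < G.minArcSum) ∧
    (∀ m : ℕ, 1 ≤ m →
      IsLeast (MultiDigraph.minArcSumValues m) (MultiDigraph.extremalMinArcSum m)) ∧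
    (fun m : ℕ => MultiDigraph.extremalMinArcSum m - Real.exp 1 * Real.log (m : ℝ))
      =O[atTop] (fun m : ℕ => 1 / Real.log (m : ℝ)) := by
  refine ⟨?_, fun m hm => MultiDigraph.isLeast_extremalMinArcSum hm,
    MultiDigraph.extremalMinArcSum_isBigO⟩
  rintro V A _ _ G hG _ hm rfl
  have : Nonempty A := Fintype.card_pos_iff.1 hm
  exact ⟨MultiDigraph.isLeast_minArcSum G, MultiDigraph.exp_one_mul_log_lt_minArcSum hG⟩
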